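/- Let $D$ be a link diagram on $S^2$ with crossings $c^1,\dots,c^n$. A (Kauffman) state $x$ of $D$ chooses an $A$- or a $B$-smoothing at each crossing; it consists of disjoint state circles joined by one $A$- or $B$-labeled crossing arc for each crossing. An enhancement $X$ of $x$ labels each state circle of $x$ by $0$ or $1$. For $R=\mathbb F_2$ or $R=\mathbb Z$, let $\mathcal C_R(D)$ be the free $R$-module on all enhanced states of $D$. Identify an enhancement of a state with a tensor of factors $q^a$, one for each state circle, where $a$ is its label ($q^0=1$, $q^1=q$). The Khovanov differential is $$dX=\sum_t(-1)^{\#\{s<t\,:\,X\text{ has an }A\text{-smoothing at }c^s\}}\,d_{c^t}X ,$$ where $d_{c}X=0$ if $X$ has a $B$-smoothing at $c$, and otherwise $d_c$ changes the smoothing at $c$ from $A$ to $B$, keeps the labels of the circles not incident to $c$, and acts on the circles at $c$ by $q\otimes q\mapsto 0$, $\;1\otimes q,\ q\otimes 1\mapsto q$, $\;1\otimes1\mapsto1$ if two circles merge, and by $q\mapsto q\otimes q$, $\;1\mapsto q\otimes1+1\otimes q$ if one circle splits. Its homology is $Kh_R(D)=\ker d/\operatorname{im}d$. The state graph $G_x$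 has the state circles of $x$ as vertices and the crossing arcs as edges. The blocks of $x$ correspond to the components obtained by cutting $G_x$ simultaneously along all its cut vertices. The state $x$ is *homogeneously adequate* if each crossing arc joins two distinct state circles and no block contains both $A$- and $B$-type crossing arcs. The *$A$-zones* (*$B$-zones*) of $x$ are the connected components of the union of all $A$-type ($B$-type) crossing arcs and their incident state circles. A zone is bipartite if the graph with its circles as vertices and its crossing arcs as edges is bipartite. An *$A$-move* exchanges the labels of the two state circles joined by an $A$-type crossing arc, where these labels are $0$ and $1$; let $\sim_A$ be the equivalence relation on enhancements generated by $A$-moves. Put $\mathrm{tr}_{\mathbb F_2}X=\sum_{Y\sim_A X}Y\in\mathcal C_{\mathbb F_2}(D)$ and, if every $A$-zone containing a $0$-labeled circle in $X$ is bipartite, $\mathrm{tr}_{\mathbb Z}X=\sum_{Y\sim_A X}\operatorname{sgn}(X\to Y)\,Y\in\mathcal C_{\mathbb Z}(D)$, where $\operatorname{sgn}(X\to Y)$ is $1$ or $-1$ according to whether an even or odd number of $A$-moves takes $X$ to $Y$. **Proposition.** Let $x$ be a homogeneously adequate state of $D$, and let $X$ be an enhancement of $x$ with at most one $0$-labeled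 state circle in each $A$-zone of $x$ and at most one $1$-labeled state circle in each $B$-zone of $x$. Then $\mathrm{tr}_{\mathbb F_2}X$ represents a nonzero class in $Kh_{\mathbb F_2}(D)$: it is a cycle and not a boundary. Further, if every $A$-zone that contains a $0$-labeled circle in $X$ is bipartite, then $\mathrm{tr}_{\mathbb Z}X$ represents a nonzero class in $Kh_{\mathbb Z}(D)$. -/

import Mathlib

/-- The two ways of smoothing a crossing. -/
inductive Smoothing where
  | A
  | B
  deriving DecidableEq

instance : Fintype Smoothing where
  elems := {Smoothing.A, Smoothing.B}
  complete := by intro x; cases x <;> simp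

/-- An unoriented link diagram on the sphere, as a planar combinatorial map (planar diagram code).

The crossings are indexed by `Fin n`. The pairs `(c, 0), (c, 1), (c, 2), (c, 3)` are the four ends of
strands at the crossing `c` in counterclockwise order; `(c, 0)` and `(c, 2)` are the ends of the
under-strand, `(c, 1)` and `(c, 3)` those of the over-strand. The involution `glue` pairs
the two ends of each edge of the diagram. There are `m` further components without crossings.

The diagram need not be connected. The field `euler` is Euler's formula `V - E + F = 2 C` for the
underlying 4-valent graph, where `V = n`, `E = 2 n`, the faces are the cycles of the permutation
"follow the edge to its other end, then turn to the next end counterclockwise", and `C` is the number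
of connected components; it says that every component is drawn on a sphere. -/
structure LinkDiagram where
  n : ℕ
  m : ℕ
  glue : Fin n × Fin 4 → Fin n × Fin 4
  glue_glue : ∀ h, glue (glue h) = h
  glue_ne : ∀ h, glue h ≠ h
  euler : Nat.card (Quot fun h h' : Fin n × Fin 4 => h' = ((glue h).1, (glue h).2 + 1)) =
    n + 2 * Nat.card (Quot fun h h' : Fin n × Fin 4 => h' = glue h ∨ h'.1 = h.1)

namespace LinkDiagram

/-- A Kauffman state: a choice of smoothing at each crossing. -/
abbrev State (D : LinkDiagram) : Type := Fin D.n → Smoothing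

namespace State

variable {D : LinkDiagram}

/-- The end of strand that is joined to `h` after smoothing. The `A`-smoothing (which joins the two
regions swept out when the over-strand turns counterclockwise) has the arcs `0 - 1` and `2 - 3`;
the `B`-smoothing has the arcs `1 - 2` and `3 - 0`. -/
def arc (x : D.State) (h : Fin D.n × Fin 4) : Fin D.n × Fin 4 :=
  match x h.1 with
  | Smoothing.A => (h.1, ![1, 0, 3, 2] h.2)
  | Smoothing.B => (h.1, ![3, 2, 1, 0] h.2)

/-- The state circles: the closed curves made of the edges of the diagram and the smoothing arcs, and the
components without crossings. -/
abbrev Circle (x : D.State) : Type :=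
  (Quot fun h h' : Fin D.n × Fin 4 => h' = D.glue h ∨ h' = x.arc h) ⊕ Fin D.m

/-- The state circle through the end of strand `h`. -/
def circ (x : D.State) (h : Fin D.n × Fin 4) : x.Circle := Sum.inl (Quot.mk _ h)

/-- One end of the crossing arc at `c`. For either smoothing, `(c, 0)` and `(c, 2)` lie on
different smoothing arcs, so the crossing arc joins `x.end₀ c` and `x.end₂ c`. -/
def end₀ (x : D.State) (c : Fin D.n) : x.Circle := x.circ (c, 0)

/-- The other end of the crossing arc at `c`. -/
def end₂ (x : D.State) (c : Fin D.n) : x.Circle := x.circ (c, 2)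

/-- Each crossing arc joins distinct state circles. -/
def Adequate (x : D.State) : Prop := ∀ c, x.end₀ c ≠ x.end₂ c

/-! The state graph has the state circles as vertices and the crossing arcs as edges. -/

/-- The edge `c` of the state graph joins `u` and `v`. -/
def Joins (x : D.State) (c : Fin D.n) (u v : x.Circle) : Prop :=
  (x.end₀ c = u ∧ x.end₂ c = v) ∨ (x.end₀ c = v ∧ x.end₂ c = u)

/-- `u` and `w` lie in the same component of the state graph. -/
def Connected (x : D.State) (u w : x.Circle) : Prop :=
  Relation.ReflTransGen (fun a b => ∃ c, x.Joins c a b) u w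

/-- `u` and `w` are vertices in the same component of the state graph with the vertex `v` deleted. -/
def ConnectedAvoiding (x : D.State) (v u w : x.Circle) : Prop :=
  u ≠ v ∧ Relation.ReflTransGen (fun a b => b ≠ v ∧ ∃ c, x.Joins c a b) u w

/-- Deleting `v` disconnects (the component of `v` in) the state graph. -/
def IsCutVertex (x : D.State) (v : x.Circle) : Prop :=
  ∃ u w, u ≠ v ∧ w ≠ v ∧ x.Connected u w ∧ ¬ x.ConnectedAvoiding v u w

/-- The edges `c` and `c'` have a common end `v` and stay attached to each other there when the state
graph is cut along its cut vertices: `v` is not a cut vertex, or `c` and `c'` lead from `v` into the same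
component of the complement of `v`. -/
def Attached (x : D.State) (c c' : Fin D.n) : Prop :=
  ∃ v u u', x.Joins c v u ∧ x.Joins c' v u' ∧
    (¬ x.IsCutVertex v ∨ x.ConnectedAvoiding v u u')

/-- The crossing arcs `c` and `c'` lie in the same block. -/
def SameBlock (x : D.State) : Fin D.n → Fin D.n → Prop := Relation.EqvGen x.Attached

/-- No block contains both `A`-type and `B`-type crossing arcs. -/
def Homogeneous (x : D.State) : Prop := ∀ c c', x.SameBlock c c' → x c = x c'

def HomogeneouslyAdequate (x : D.State) : Prop := x.Adequate ∧ x.Homogeneous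

/-- `Z` is the set of state circles of a zone of type `s`, that is, of a connected component of the
union of all `s`-type crossing arcs and their incident state circles. -/
def IsZone (x : D.State) (s : Smoothing) (Z : Set x.Circle) : Prop :=
  ∃ c, x c = s ∧
    Z = {u | Relation.EqvGen (fun a b => ∃ c', x c' = s ∧ x.Joins c' a b) (x.end₀ c) u}

/-- The part of the state graph with vertices `Z` and the `s`-type edges between them is bipartite. -/
def IsBipartite (x : D.State) (s : Smoothing) (Z : Set x.Circle) : Prop :=
  ∃ f : x.Circle → Fin 2, ∀ c, x c = s → x.end₀ c ∈ Z → x.end₂ c ∈ Z → f (x.end₀ c) ≠ f (x.end₂ c)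

/-- An enhancement of a state: a label `0` or `1` on each state circle. -/
abbrev Enhancement (x : D.State) : Type := x.Circle → Fin 2

/-- `X` and `Y` differ by exchanging the labels `0`, `1` of the two state circles at an `s`-type crossing
arc. -/
def Move (x : D.State) (s : Smoothing) (X Y : x.Enhancement) : Prop :=
  ∃ c, x c = s ∧ X (x.end₀ c) ≠ X (x.end₂ c) ∧
    Y (x.end₀ c) = X (x.end₂ c) ∧ Y (x.end₂ c) = X (x.end₀ c) ∧
    ∀ u, u ≠ x.end₀ c → u ≠ x.end₂ c → Y u = X u

/-- The equivalence relation generated by the moves of type `s`. -/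
def Equivalent (x : D.State) (s : Smoothing) : x.Enhancement → x.Enhancement → Prop :=
  Relation.EqvGen (x.Move s)

/-- `x.Moves s k X Y`: a sequence of `k` moves of type `s` takes `X` to `Y`. -/
inductive Moves (x : D.State) (s : Smoothing) : ℕ → x.Enhancement → x.Enhancement → Prop
  | refl (X : x.Enhancement) : Moves x s 0 X X
  | step {k : ℕ} {X Y Z : x.Enhancement} : Moves x s k X Y → x.Move s Y Z → Moves x s (k + 1) X Z

open Classical in
/-- The sign of `X → Y`, for `A`-equivalent `X` and `Y`: `1` or `-1` according to whether an even or
odd number of `A`-moves takes `X` to `Y`. (The parity does not depend on the moves if every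
non-bipartite `A`-zone is labeled `1` throughout.) -/
noncomputable def sgn (x : D.State) (X Y : x.Enhancement) : ℤ :=
  if ∃ k, Even k ∧ x.Moves Smoothing.A k X Y then 1 else -1

noncomputable instance (x : D.State) : Fintype x.Enhancement := Fintype.ofFinite _

end State

/-- The enhanced states of the diagram. -/
abbrev EnhancedState (D : LinkDiagram) : Type := Σ x : D.State, x.Enhancement

variable {D : LinkDiagram}

/-- The label of the state circle through the end of strand `h`. -/
def EnhancedState.label (X : D.EnhancedState) (h : Fin D.n × Fin 4) : Fin 2 := X.2 (X.1.circ h)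

/-- `Y` occurs (with coefficient `1`) in the differential of `X` at the crossing `c`.

The smoothing at `c` changes from `A` to `B`, the state circles away from `c` keep their labels, and
at `c` either two circles labeled `a`, `a'` merge to one labeled `a + a'`
(`1 ⊗ 1 ↦ 1`, `1 ⊗ q ↦ q`, `q ⊗ 1 ↦ q`, `q ⊗ q ↦ 0`, where `q ^ a` stands for the label `a`), or
one circle labeled `a` splits into two whose labels have the sum `a + 1`
(`1 ↦ q ⊗ 1 + 1 ⊗ q`, `q ↦ q ⊗ q`). -/
def Incident (c : Fin D.n) (X Y : D.EnhancedState) : Prop :=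
  X.1 c = Smoothing.A ∧ Y.1 = Function.update X.1 c Smoothing.B ∧
  (∀ i : Fin D.m, Y.2 (Sum.inr i) = X.2 (Sum.inr i)) ∧
  (∀ h, X.1.circ h ≠ X.1.end₀ c → X.1.circ h ≠ X.1.end₂ c → Y.label h = X.label h) ∧
  ((X.1.end₀ c ≠ X.1.end₂ c ∧ Y.1.end₀ c = Y.1.end₂ c ∧
      (Y.label (c, 0) : ℕ) = (X.label (c, 0) : ℕ) + (X.label (c, 2) : ℕ)) ∨
    (X.1.end₀ c = X.1.end₂ c ∧ Y.1.end₀ c ≠ Y.1.end₂ c ∧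
      (Y.label (c, 0) : ℕ) + (Y.label (c, 2) : ℕ) = (X.label (c, 0) : ℕ) + 1))

noncomputable instance (D : LinkDiagram) : Fintype D.EnhancedState := Fintype.ofFinite _

/-- The Khovanov chains: the free `R`-module on the (finitely many) enhanced states. The coefficient of
`X` in the chain `z` is `z X`, and `Pi.single X 1` is the enhanced state `X` as a chain. -/
abbrev Chains (D : LinkDiagram) (R : Type) : Type := D.EnhancedState → R

/-- The sign of the differential of the enhanced state `X` at the crossing `c`, given by the number of
crossings before `c` with an `A`-smoothing. -/
def crossingSign (c : Fin D.n) (X : D.EnhancedState) : ℤ :=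
  (-1) ^ (Finset.univ.filter (fun c' => c' < c ∧ X.1 c' = Smoothing.A)).card

open Classical in
/-- The matrix of the differential: the entry at `Y`, `X` is the coefficient of `Y` in the differential
of `X`. -/
noncomputable def dMatrix (D : LinkDiagram) (R : Type) [CommRing R] :
    Matrix D.EnhancedState D.EnhancedState R :=
  fun Y X => ∑ c : Fin D.n, if Incident c X Y then (crossingSign c X : R) else 0

/-- The Khovanov differential. -/
noncomputable def d (D : LinkDiagram) (R : Type) [CommRing R] : D.Chains R →ₗ[R] D.Chains R :=
  (D.dMatrix R).mulVecLin

/-- Khovanov homology: cycles modulo boundaries. -/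
abbrev Kh (D : LinkDiagram) (R : Type) [CommRing R] : Type :=
  LinearMap.ker (D.d R) ⧸ (LinearMap.range (D.d R)).submoduleOf (LinearMap.ker (D.d R))

/-- The chain `z` is a cycle and its homology class is nonzero. -/
def RepresentsNonzeroClass {R : Type} [CommRing R] (z : D.Chains R) : Prop :=
  ∃ hz : z ∈ LinearMap.ker (D.d R), (Submodule.Quotient.mk ⟨z, hz⟩ : D.Kh R) ≠ 0

open Classical in
/-- The `A`-trace over the field with two elements. -/
noncomputable def traceF₂ (x : D.State) (X : x.Enhancement) : D.Chains (ZMod 2) :=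
  ∑ Y ∈ Finset.univ.filter (fun Y => x.Equivalent Smoothing.A X Y),
    Pi.single (⟨x, Y⟩ : D.EnhancedState) 1

open Classical in
/-- The `A`-trace over the integers, meaningful if every non-bipartite `A`-zone is labeled `1`
throughout. -/
noncomputable def traceℤ (x : D.State) (X : x.Enhancement) : D.Chains ℤ :=
  ∑ Y ∈ Finset.univ.filter (fun Y => x.Equivalent Smoothing.A X Y),
    Pi.single (⟨x, Y⟩ : D.EnhancedState) (x.sgn X Y)

end LinkDiagram

/-!
Every crossing arc of an adequate state `x` joins two distinct circles, so exchanging the labels of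
these two circles is an involution on the enhancements of `x`; it permutes each equivalence class of
moves of the type of the crossing, and the whole proof is a sequence of cancellations along such
involutions.

*The trace is a cycle.* Let `c` be an `A`-crossing of `x` and `Y` a summand of the trace. The circles
at `c` merge in `d_c Y`. Since no `A`-zone contains two `0`-labels, a property which is invariant
under `A`-moves, the labels at `c` are `1, 1`, in which case `d_c Y = 0`, or `0, 1`, in which case
exchanging them leaves `d_c Y` the same. So the summands cancel in pairs, modulo `2` or, over `ℤ`,
because the exchange reverses the sign (`sum_incident_target_eq_zero`). That the sign is well defined
is seen from the sum of the colors of the `0`-labeled circles, for a `2`-coloring of the zones that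
contain one: every `A`-move changes its parity (`sgn_swapLabels`).

*The trace is not a boundary.* Modulo `2`, the same argument with `A`, `B` and `0`, `1` exchanged
shows that summing the coefficients over all enhancements `B`-equivalent to `X` is a functional that
vanishes on boundaries (`sum_incident_source_eq_zero`). Its value on the `A`-trace is the number of
enhancements which are both `A`- and `B`-equivalent to `X`. By homogeneity, `X` is the only one
(`Equivalent.eq_of_equivalent`): for a circle `v`, let `S` be the part of the state graph minus `v`
that is attached to `v` by `A`-arcs. No `B`-arc joins `v` to `S`, so `B`-moves preserve the sum of
the labels on `S`, and every `A`-arc at `v` leads to `S`, so `A`-moves preserve the sum of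
the labels on `S ∪ {v}`; hence the label of `v` is determined. So the functional takes the value `1`
on the trace. The integral statement follows by reduction modulo `2`.
-/

namespace LinkDiagram

variable {D : LinkDiagram}

namespace State

variable {x : D.State} {s : Smoothing}

/-! ### Moves as exchanges of labels -/

open Classical in
/-- The enhancement `X` with the labels of the two state circles at the crossing `c` exchanged. -/
noncomputable def swapLabels (x : D.State) (c : Fin D.n) (X : x.Enhancement) : x.Enhancement :=
  fun u => X (Equiv.swap (x.end₀ c) (x.end₂ c) u)

@[simp]
theorem swapLabels_end₀ (c : Fin D.n) (X : x.Enhancement) :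
    x.swapLabels c X (x.end₀ c) = X (x.end₂ c) := by
  simp [swapLabels]

@[simp]
theorem swapLabels_end₂ (c : Fin D.n) (X : x.Enhancement) :
    x.swapLabels c X (x.end₂ c) = X (x.end₀ c) := by
  simp [swapLabels]

theorem swapLabels_of_ne {c : Fin D.n} {u : x.Circle} (X : x.Enhancement) (h₀ : u ≠ x.end₀ c)
    (h₂ : u ≠ x.end₂ c) : x.swapLabels c X u = X u := by
  classical
  simp [swapLabels, Equiv.swap_apply_of_ne_of_ne h₀ h₂]

@[simp]
theorem swapLabels_swapLabels (c : Fin D.n) (X : x.Enhancement) :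
    x.swapLabels c (x.swapLabels c X) = X := by
  funext u
  simp [swapLabels]

theorem swapLabels_ne {c : Fin D.n} {X : x.Enhancement} (h : X (x.end₀ c) ≠ X (x.end₂ c)) :
    x.swapLabels c X ≠ X := by
  intro e
  apply h
  conv_lhs => rw [← e]
  simp

theorem swapLabels_eq_self {c : Fin D.n} {X : x.Enhancement} (h : X (x.end₀ c) = X (x.end₂ c)) :
    x.swapLabels c X = X := by
  funext u
  by_cases h₀ : u = x.end₀ c
  · subst h₀; simp [h]
  by_cases h₂ : u = x.end₂ c
  · subst h₂; simp [h]
  exact swapLabels_of_ne X h₀ h₂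

theorem move_swapLabels {c : Fin D.n} {X : x.Enhancement} (hc : x c = s)
    (h : X (x.end₀ c) ≠ X (x.end₂ c)) : x.Move s X (x.swapLabels c X) :=
  ⟨c, hc, h, by simp, by simp, fun _ h₀ h₂ => swapLabels_of_ne X h₀ h₂⟩

theorem Move.exists_eq_swapLabels {X Y : x.Enhancement} (h : x.Move s X Y) :
    ∃ c, x c = s ∧ X (x.end₀ c) ≠ X (x.end₂ c) ∧ Y = x.swapLabels c X := by
  obtain ⟨c, hc, hne, h₀, h₂, h⟩ := h
  refine ⟨c, hc, hne, funext fun u => ?_⟩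
  by_cases e₀ : u = x.end₀ c
  · subst e₀; simp [h₀]
  by_cases e₂ : u = x.end₂ c
  · subst e₂; simp [h₂]
  rw [h u e₀ e₂, swapLabels_of_ne X e₀ e₂]

theorem equivalent_swapLabels {c : Fin D.n} (X : x.Enhancement) (hc : x c = s) :
    x.Equivalent s X (x.swapLabels c X) := by
  by_cases h : X (x.end₀ c) = X (x.end₂ c)
  · rw [swapLabels_eq_self h]
    exact .refl _
  · exact .rel _ _ (move_swapLabels hc h)

/-- A quantity that does not change when labels are exchanged along `s`-type crossing arcs is an
invariant of `s`-equivalence. -/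
theorem Equivalent.invariant {α : Sort*} {P : x.Enhancement → α} {X Y : x.Enhancement}
    (h : x.Equivalent s X Y)
    (hP : ∀ (c : Fin D.n) (W : x.Enhancement), x c = s → P (x.swapLabels c W) = P W) :
    P Y = P X := by
  induction h with
  | rel X Y h =>
    obtain ⟨c, hc, -, rfl⟩ := h.exists_eq_swapLabels
    exact hP c X hc
  | refl => rfl
  | symm _ _ _ ih => exact ih.symm
  | trans _ _ _ _ _ ih₁ ih₂ => exact ih₂.trans ih₁

/-! ### Zones -/

/-- The zone, of type `x c`, that contains the crossing arc at `c`. -/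
def zone (x : D.State) (c : Fin D.n) : Set x.Circle :=
  {u | Relation.EqvGen (fun a b => ∃ c', x c' = x c ∧ x.Joins c' a b) (x.end₀ c) u}

theorem isZone_zone {c : Fin D.n} (hc : x c = s) : x.IsZone s (x.zone c) :=
  ⟨c, hc, by subst hc; rfl⟩

theorem end₀_mem_zone (c : Fin D.n) : x.end₀ c ∈ x.zone c := .refl _

theorem IsZone.end₀_mem_iff {Z : Set x.Circle} (hZ : x.IsZone s Z) {c : Fin D.n} (hc : x c = s) :
    x.end₀ c ∈ Z ↔ x.end₂ c ∈ Z := by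
  obtain ⟨c₀, -, rfl⟩ := hZ
  exact ⟨fun h => h.trans _ _ _ (.rel _ _ ⟨c, hc, .inl ⟨rfl, rfl⟩⟩),
    fun h => h.trans _ _ _ (.rel _ _ ⟨c, hc, .inr ⟨rfl, rfl⟩⟩)⟩

theorem end₂_mem_zone (c : Fin D.n) : x.end₂ c ∈ x.zone c :=
  ((isZone_zone rfl).end₀_mem_iff rfl).1 (end₀_mem_zone c)

/-- Exchanging the labels at an `s`-type crossing permutes the circles of each `s`-zone. -/
theorem IsZone.exists_perm_swapLabels {Z : Set x.Circle} (hZ : x.IsZone s Z) {c : Fin D.n}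
    (hc : x c = s) : ∃ σ : Equiv.Perm x.Circle, (∀ u, σ u ∈ Z ↔ u ∈ Z) ∧
      ∀ (X : x.Enhancement) (u : x.Circle), x.swapLabels c X u = X (σ u) := by
  classical
  refine ⟨Equiv.swap (x.end₀ c) (x.end₂ c), fun u => ?_, fun X u => by simp [swapLabels]⟩
  rw [Equiv.swap_apply_def]
  split_ifs with h₀ h₂
  · rw [h₀, hZ.end₀_mem_iff hc]
  · rw [h₂, hZ.end₀_mem_iff hc]
  · rfl

theorem Equivalent.subsingleton_iff {Z : Set x.Circle} (hZ : x.IsZone s Z) {X Y : x.Enhancement}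
    (h : x.Equivalent s X Y) (a : Fin 2) :
    {u | u ∈ Z ∧ Y u = a}.Subsingleton ↔ {u | u ∈ Z ∧ X u = a}.Subsingleton := by
  refine iff_of_eq (h.invariant (P := fun W => {u | u ∈ Z ∧ W u = a}.Subsingleton)
    fun c W hc => ?_)
  obtain ⟨σ, hσ, e⟩ := hZ.exists_perm_swapLabels hc
  have : {u | u ∈ Z ∧ x.swapLabels c W u = a} = σ ⁻¹' {u | u ∈ Z ∧ W u = a} := by
    ext u; simp [hσ, e]
  simp only [this, eq_iff_iff]
  exact ⟨fun h => (Set.Subsingleton.image h σ).anti (by rw [σ.image_preimage]),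
    fun h => h.preimage σ.injective⟩

theorem Equivalent.exists_label_iff {Z : Set x.Circle} (hZ : x.IsZone s Z) {X Y : x.Enhancement}
    (h : x.Equivalent s X Y) (a : Fin 2) : (∃ u ∈ Z, Y u = a) ↔ ∃ u ∈ Z, X u = a := by
  refine iff_of_eq (h.invariant (P := fun W => ∃ u ∈ Z, W u = a) fun c W hc => ?_)
  obtain ⟨σ, hσ, e⟩ := hZ.exists_perm_swapLabels hc
  rw [eq_iff_iff, ← σ.exists_congr_right (q := fun u => u ∈ Z ∧ W u = a)]
  simp [hσ, e]

/-- If the zone of `c` has at most one label `a`, then the labels at `c` are not both `a`, for all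
enhancements equivalent to the given one. -/
theorem Equivalent.not_both {X Y : x.Enhancement} (hx : x.Adequate) (h : x.Equivalent s X Y)
    {a : Fin 2} (ha : ∀ Z : Set x.Circle, x.IsZone s Z → {u | u ∈ Z ∧ X u = a}.Subsingleton)
    {c : Fin D.n} (hc : x c = s) : ¬ (Y (x.end₀ c) = a ∧ Y (x.end₂ c) = a) := fun ⟨h₀, h₂⟩ =>
  hx c ((h.subsingleton_iff (isZone_zone hc) a).2 (ha _ (isZone_zone hc))
    ⟨end₀_mem_zone c, h₀⟩ ⟨end₂_mem_zone c, h₂⟩)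

/-! ### The sign of an equivalence -/

theorem Equivalent.exists_moves {X Y : x.Enhancement} (h : x.Equivalent s X Y) :
    ∃ k, x.Moves s k X Y := by
  have hstep : ∀ (c : Fin D.n) (W : x.Enhancement), x c = s → (∃ k, x.Moves s k X W) →
      ∃ k, x.Moves s k X (x.swapLabels c W) := by
    rintro c W hc ⟨k, hk⟩
    by_cases hW : W (x.end₀ c) = W (x.end₂ c)
    · exact ⟨k, by rwa [swapLabels_eq_self hW]⟩
    · exact ⟨k + 1, hk.step (move_swapLabels hc hW)⟩
  rw [h.invariant (P := fun W => ∃ k, x.Moves s k X W) fun c W hc =>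
    propext ⟨fun h => by simpa using hstep c _ hc h, hstep c W hc⟩]
  exact ⟨0, .refl X⟩

theorem Moves.equivalent {k : ℕ} {X Y : x.Enhancement} (h : x.Moves s k X Y) :
    x.Equivalent s X Y := by
  induction h with
  | refl => exact .refl _
  | step _ h ih => exact ih.trans _ _ _ (.rel _ _ h)

/-- If all `s`-zones that contain a `0`-label are bipartite, then their colorings combine to one
function on the set of state circles. -/
theorem exists_coloring {X : x.Enhancement}
    (hX : ∀ Z : Set x.Circle, x.IsZone s Z → (∃ u ∈ Z, X u = 0) → x.IsBipartite s Z) :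
    ∃ f : x.Circle → ZMod 2, ∀ c, x c = s → (∃ u ∈ x.zone c, X u = 0) →
      f (x.end₀ c) + f (x.end₂ c) = 1 := by
  choose! g hg using hX
  let r : Setoid x.Circle := Relation.EqvGen.setoid fun a b => ∃ c', x c' = s ∧ x.Joins c' a b
  refine ⟨fun u => g {w | r u w} u, fun c hc h0 => ?_⟩
  have e₀ : {w | r (x.end₀ c) w} = x.zone c := by subst hc; rfl
  have e₂ : {w | r (x.end₂ c) w} = x.zone c := by
    rw [← e₀]
    have h : r (x.end₀ c) (x.end₂ c) := .rel _ _ ⟨c, hc, .inl ⟨rfl, rfl⟩⟩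
    ext w
    exact ⟨fun h' => r.trans h h', fun h' => r.trans (r.symm h) h'⟩
  have := hg _ (isZone_zone hc) h0 c hc (end₀_mem_zone c) (end₂_mem_zone c)
  simp only [e₀, e₂]
  have h2 : ∀ a b : ZMod 2, a ≠ b → a + b = 1 := by decide
  exact h2 _ _ this

/-- The number of moves between two enhancements is well defined modulo `2`: it is measured by the
sum of the colors of the `0`-labeled circles. -/
theorem exists_parity {X : x.Enhancement} (hx : x.Adequate)
    (hX : ∀ Z : Set x.Circle, x.IsZone s Z → (∃ u ∈ Z, X u = 0) → x.IsBipartite s Z) :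
    ∃ P : x.Enhancement → ZMod 2, ∀ k Y, x.Moves s k X Y → P Y = P X + k := by
  classical
  obtain ⟨f, hf⟩ := exists_coloring hX
  have := Fintype.ofFinite x.Circle
  refine ⟨fun Y => ∑ u, if Y u = 0 then f u else 0, fun k Y h => ?_⟩
  induction h with
  | refl => simp
  | @step k X Y Z h hm ih =>
    obtain ⟨c, hc, hne, rfl⟩ := hm.exists_eq_swapLabels
    specialize ih hX hf
    have h0 : ∃ u ∈ x.zone c, X u = 0 := by
      refine (h.equivalent.exists_label_iff (isZone_zone hc) 0).1 ?_
      by_cases h0 : Y (x.end₀ c) = 0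
      · exact ⟨_, end₀_mem_zone c, h0⟩
      · exact ⟨_, end₂_mem_zone c, by omega⟩
    have key : ∑ u, ((if x.swapLabels c Y u = 0 then f u else 0) -
        (if Y u = 0 then f u else 0)) = f (x.end₀ c) + f (x.end₂ c) := by
      rw [Finset.sum_eq_add (x.end₀ c) (x.end₂ c) (hx c)
        (fun u _ hu => by rw [swapLabels_of_ne Y hu.1 hu.2, sub_self]) (by simp) (by simp)]
      rw [swapLabels_end₀, swapLabels_end₂]
      generalize Y (x.end₀ c) = a at *
      generalize Y (x.end₂ c) = b at *
      generalize f (x.end₀ c) = p at *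
      generalize f (x.end₂ c) = q at *
      clear hf ih h hm hX h0
      revert a b p q
      decide
    rw [hf c hc h0, Finset.sum_sub_distrib, sub_eq_iff_eq_add] at key
    simp only at ih ⊢
    rw [key, ih]
    push_cast
    ring

theorem sgn_swapLabels {X Y : x.Enhancement} (hx : x.Adequate)
    (hX : ∀ Z : Set x.Circle, x.IsZone Smoothing.A Z → (∃ u ∈ Z, X u = 0) →
      x.IsBipartite Smoothing.A Z)
    (h : x.Equivalent Smoothing.A X Y) {c : Fin D.n} (hc : x c = Smoothing.A)
    (hne : Y (x.end₀ c) ≠ Y (x.end₂ c)) :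
    x.sgn X (x.swapLabels c Y) = - x.sgn X Y := by
  obtain ⟨P, hP⟩ := exists_parity hx hX
  obtain ⟨k, hk⟩ := h.exists_moves
  have hk' := hk.step (move_swapLabels hc hne)
  -- the parity of one sequence of moves decides the sign
  have key : ∀ {k Y}, x.Moves Smoothing.A k X Y →
      ((∃ k, Even k ∧ x.Moves Smoothing.A k X Y) ↔ Even k) := fun {k Y} hk =>
    ⟨fun ⟨l, hl, h⟩ => by
      have := (hP _ _ h).symm.trans (hP _ _ hk)
      rw [add_right_inj, ZMod.natCast_eq_natCast_iff'] at this
      rw [Nat.even_iff] at hl ⊢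
      omega, fun h => ⟨k, h, hk⟩⟩
  simp only [sgn, key hk, key hk', Nat.even_add_one]
  by_cases he : Even k <;> simp [he]

/-! ### Homogeneity -/

/-- In a homogeneously adequate state, the labels of an enhancement cannot be changed both by moves
of type `A` only and by moves of type `B` only. -/
theorem Equivalent.eq_of_equivalent (hx : x.HomogeneouslyAdequate) {X Y : x.Enhancement}
    (hA : x.Equivalent Smoothing.A X Y) (hB : x.Equivalent Smoothing.B X Y) : Y = X := by
  classical
  have := Fintype.ofFinite x.Circle
  funext v
  -- the part of the state graph minus `v` that is attached to `v` by `A`-type arcs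
  let S : Set x.Circle := {u | ∃ c u₀, x c = Smoothing.A ∧ x.Joins c v u₀ ∧
    x.ConnectedAvoiding v u₀ u}
  have hv : v ∉ S := by
    rintro ⟨c, u₀, -, -, h, h'⟩
    cases h' with
    | refl => exact h rfl
    | tail _ h => exact h.1 rfl
  have hjoin : ∀ {c u}, x.Joins c v u → (u ∈ S ↔ x c = Smoothing.A) := by
    intro c u h
    refine ⟨fun ⟨c₀, u₀, hc₀, h₀, h'⟩ => ?_, fun hc => ⟨c, u, hc, h, ?_, .refl⟩⟩
    · rw [← hx.2 c₀ c (.rel _ _ ⟨v, u₀, u, h₀, h, .inr h'⟩), hc₀]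
    · rintro rfl
      rcases h with ⟨h₀, h₂⟩ | ⟨h₀, h₂⟩ <;> exact hx.1 c (h₀.trans h₂.symm)
  have hstep : ∀ {c a b}, x.Joins c a b → b ≠ v → a ∈ S → b ∈ S :=
    fun h hb ⟨c₀, u₀, hc₀, h₀, h', h''⟩ => ⟨c₀, u₀, hc₀, h₀, h', h''.tail ⟨hb, _, h⟩⟩
  have hmem : ∀ c, x.end₀ c ≠ v → x.end₂ c ≠ v → (x.end₀ c ∈ S ↔ x.end₂ c ∈ S) := fun c h₀ h₂ =>
    ⟨hstep (.inl ⟨rfl, rfl⟩) h₂, hstep (.inr ⟨rfl, rfl⟩) h₀⟩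
  -- the sum of labels over a set that contains both or none of the circles at `c`
  let total (T : Set x.Circle) (W : x.Enhancement) : ℕ := ∑ u, T.indicator (fun u => (W u : ℕ)) u
  have hsum : ∀ (T : Set x.Circle) (c : Fin D.n) (W : x.Enhancement),
      (x.end₀ c ∈ T ↔ x.end₂ c ∈ T) → total T (x.swapLabels c W) = total T W := by
    intro T c W hT
    simp only [total]
    rw [← Equiv.sum_comp (Equiv.swap (x.end₀ c) (x.end₂ c)) (T.indicator fun u => (W u : ℕ))]
    refine Finset.sum_congr rfl fun u _ => ?_
    have : Equiv.swap (x.end₀ c) (x.end₂ c) u ∈ T ↔ u ∈ T := by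
      rw [Equiv.swap_apply_def]
      split_ifs with h₀ h₂
      · rw [h₀, hT]
      · rw [h₂, hT]
      · rfl
    simp [swapLabels, Set.indicator_apply, this]
  have hB' : total S Y = total S X := hB.invariant fun c W hc => by
    refine hsum S c W ?_
    by_cases h₀ : x.end₀ c = v
    · simp [h₀, hv, hjoin (.inl ⟨h₀, rfl⟩ : x.Joins c v (x.end₂ c)), hc]
    by_cases h₂ : x.end₂ c = v
    · simp [h₂, hv, hjoin (.inr ⟨rfl, h₂⟩ : x.Joins c v (x.end₀ c)), hc]
    exact hmem c h₀ h₂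
  have hA' : total (insert v S) Y = total (insert v S) X := hA.invariant fun c W hc => by
    refine hsum (insert v S) c W ?_
    by_cases h₀ : x.end₀ c = v
    · simp [h₀, hjoin (.inl ⟨h₀, rfl⟩ : x.Joins c v (x.end₂ c)), hc]
    by_cases h₂ : x.end₂ c = v
    · simp [h₂, hjoin (.inr ⟨rfl, h₂⟩ : x.Joins c v (x.end₀ c)), hc]
    simpa [h₀, h₂] using hmem c h₀ h₂
  have hsplit : ∀ W : x.Enhancement, total (insert v S) W = W v + total S W := by
    intro W
    have : (W v : ℕ) = ∑ u, if u = v then (W u : ℕ) else 0 := by simp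
    rw [this, ← Finset.sum_add_distrib]
    refine Finset.sum_congr rfl fun u _ => ?_
    by_cases h : u = v
    · subst h; simp [hv]
    · simp [Set.indicator_apply, h]
  rw [hsplit, hsplit] at hA'
  exact Fin.ext (by omega)

/-! ### Cancellation along exchanges of labels -/

open Classical in
/-- A sum over an equivalence class of enhancements vanishes if its nonzero terms cancel against those
with the labels at `c` exchanged. -/
theorem sum_equivalent_eq_zero {R : Type} [CommRing R] {X : x.Enhancement} {c : Fin D.n}
    (hc : x c = s) (F : x.Enhancement → R)
    (hF : ∀ Y, x.Equivalent s X Y → F Y ≠ 0 →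
      Y (x.end₀ c) ≠ Y (x.end₂ c) ∧ F Y + F (x.swapLabels c Y) = 0) :
    ∑ Y ∈ Finset.univ.filter (fun Y => x.Equivalent s X Y), F Y = 0 := by
  refine Finset.sum_involution (fun Y _ => x.swapLabels c Y) (fun Y hY => ?_) (fun Y hY h => ?_)
    (fun Y hY => ?_) (fun Y _ => swapLabels_swapLabels c Y)
  · have hY := (Finset.mem_filter.1 hY).2
    by_cases h : F Y = 0
    · by_cases h' : F (x.swapLabels c Y) = 0
      · rw [h, h', add_zero]
      · have := (hF _ (hY.trans _ _ _ (equivalent_swapLabels Y hc)) h').2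
        rwa [swapLabels_swapLabels, add_comm] at this
    · exact (hF Y hY h).2
  · exact swapLabels_ne (hF Y (Finset.mem_filter.1 hY).2 h).1
  · exact Finset.mem_filter.2 ⟨Finset.mem_univ _,
      (Finset.mem_filter.1 hY).2.trans _ _ _ (equivalent_swapLabels Y hc)⟩

end State

open State

/-! ### Symmetry of the differential in the circles at a crossing -/

theorem label_mk {x : D.State} (Y : x.Enhancement) (h : Fin D.n × Fin 4) :
    EnhancedState.label ⟨x, Y⟩ h = Y (x.circ h) := rfl

/-- Merging the circles at `c` does not distinguish their labels. -/
theorem Incident.swapLabels_left {x : D.State} (hx : x.Adequate) {c : Fin D.n} {Y : x.Enhancement}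
    {W : D.EnhancedState} (h : Incident c ⟨x, Y⟩ W) : Incident c ⟨x, x.swapLabels c Y⟩ W := by
  obtain ⟨hc, hW, hm, hl, h⟩ := h
  have hinr : ∀ (i : Fin D.m) (k : Fin D.n × Fin 4), (Sum.inr i : x.Circle) ≠ x.circ k :=
    fun i k => Sum.inr_ne_inl
  refine ⟨hc, hW, fun i => ?_, fun k h₀ h₂ => ?_, .inl ?_⟩
  · exact (hm i).trans (swapLabels_of_ne Y (hinr i _) (hinr i _)).symm
  · exact (hl k h₀ h₂).trans (swapLabels_of_ne Y h₀ h₂).symm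
  · rcases h with ⟨h₁, h₂, h₃⟩ | ⟨h₁, -, -⟩
    · refine ⟨h₁, h₂, h₃.trans ?_⟩
      have e₀ := swapLabels_end₀ c Y
      have e₂ := swapLabels_end₂ c Y
      simp only [label_mk]
      rw [end₀, end₂] at e₀ e₂
      rw [e₀, e₂, add_comm]
    · exact (hx c h₁).elim

theorem Incident.ne_of_left {x : D.State} (hx : x.Adequate) {c : Fin D.n} {Y : x.Enhancement}
    {W : D.EnhancedState} (h : Incident c ⟨x, Y⟩ W)
    (h0 : ¬ (Y (x.end₀ c) = 0 ∧ Y (x.end₂ c) = 0)) : Y (x.end₀ c) ≠ Y (x.end₂ c) := by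
  obtain ⟨-, -, -, -, ⟨-, -, h⟩ | ⟨h, -⟩⟩ := h
  · simp only [label_mk] at h
    simp only [end₀, end₂] at h0 ⊢
    intro e
    omega
  · exact (hx c h).elim

/-- If the two circles at `c` come from splitting one circle, then every end of a strand on one of
them lies on the circle that is split. -/
theorem circ_eq_end₀_of_split {x w : D.State} {c : Fin D.n} (hx : x = Function.update w c .B)
    (hc : w c = .A) (he : w.end₀ c = w.end₂ c) {h : Fin D.n × Fin 4}
    (hh : x.circ h = x.end₀ c ∨ x.circ h = x.end₂ c) : w.circ h = w.end₀ c := by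
  have harc : ∀ k, w.circ (w.arc k) = w.circ k := fun k =>
    congrArg Sum.inl (Quot.sound (.inr rfl)).symm
  -- the arcs of `w` at `c` and the hypothesis put all four ends at `c` on one circle of `w`
  have hall : ∀ i, w.circ (c, i) = w.end₀ c := by
    have h₀ := harc (c, 0)
    have h₂ := harc (c, 2)
    simp only [arc, hc] at h₀ h₂
    intro i
    fin_cases i
    · rfl
    · exact h₀
    · exact he.symm
    · exact h₂.trans he.symm
  -- hence the identity on ends of strands induces a map from the circles of `x` to those of `w`
  let f : x.Circle → w.Circle := Sum.map (Quot.lift (fun k => Quot.mk _ k) (by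
    rintro k k' (rfl | rfl)
    · exact Quot.sound (.inl rfl)
    · by_cases hk : k.1 = c
      · obtain ⟨k₁, k₂⟩ := k
        obtain rfl : k₁ = c := hk
        have : ∃ j, x.arc (k₁, k₂) = (k₁, j) := by
          unfold arc; split <;> exact ⟨_, rfl⟩
        obtain ⟨j, hj⟩ := this
        rw [hj]
        exact Sum.inl_injective ((hall k₂).trans (hall j).symm)
      · have : x.arc k = w.arc k := by
          simp [arc, hx, Function.update_of_ne hk]
        rw [this]
        exact Quot.sound (.inr rfl))) id
  have hf : ∀ k, f (x.circ k) = w.circ k := fun k => rfl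
  rcases hh with hh | hh
  · rw [← hf, hh]; exact hf _
  · rw [← hf, hh, he]; exact hf _

/-- Splitting a circle at `c` does not distinguish the two resulting circles. -/
theorem Incident.swapLabels_right {x : D.State} (hx : x.Adequate) {c : Fin D.n}
    {Y : x.Enhancement} {W : D.EnhancedState} (h : Incident c W ⟨x, Y⟩) :
    Incident c W ⟨x, x.swapLabels c Y⟩ := by
  obtain ⟨hc, hW, hm, hl, h⟩ := h
  have hinr : ∀ (i : Fin D.m) (k : Fin D.n × Fin 4), (Sum.inr i : x.Circle) ≠ x.circ k :=
    fun i k => Sum.inr_ne_inl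
  rcases h with ⟨-, h₁, -⟩ | ⟨h₁, h₂, h₃⟩
  · exact (hx c h₁).elim
  refine ⟨hc, hW, fun i => ?_, fun k h₀ h₂ => ?_, .inr ⟨h₁, h₂, Eq.trans ?_ h₃⟩⟩
  · exact (swapLabels_of_ne Y (hinr i _) (hinr i _)).trans (hm i)
  · exact (swapLabels_of_ne Y
      (fun e => h₀ (circ_eq_end₀_of_split hW hc h₁ (.inl e)))
      (fun e => h₀ (circ_eq_end₀_of_split hW hc h₁ (.inr e)))).trans (hl k h₀ h₂)
  · have e₀ := swapLabels_end₀ c Y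
    have e₂ := swapLabels_end₂ c Y
    simp only [label_mk]
    rw [end₀, end₂] at e₀ e₂
    rw [e₀, e₂, add_comm]

theorem Incident.ne_of_right {x : D.State} (hx : x.Adequate) {c : Fin D.n} {Y : x.Enhancement}
    {W : D.EnhancedState} (h : Incident c W ⟨x, Y⟩)
    (h1 : ¬ (Y (x.end₀ c) = 1 ∧ Y (x.end₂ c) = 1)) : Y (x.end₀ c) ≠ Y (x.end₂ c) := by
  obtain ⟨-, -, -, -, ⟨-, h, -⟩ | ⟨-, -, h⟩⟩ := h
  · exact (hx c h).elim
  · simp only [label_mk] at h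
    simp only [end₀, end₂] at h1 ⊢
    intro e
    omega

/-! ### Sums of coefficients of the differential -/

open Classical in
/-- The coefficients of the differential cancel in a sum over an `A`-equivalence class of sources,
with weights that change sign under `A`-moves. -/
theorem sum_incident_target_eq_zero {R : Type} [CommRing R] {x : D.State} (hx : x.Adequate)
    {X : x.Enhancement}
    (hA : ∀ Z : Set x.Circle, x.IsZone Smoothing.A Z → {u | u ∈ Z ∧ X u = 0}.Subsingleton)
    (g : x.Enhancement → R)
    (hg : ∀ c Y, x c = Smoothing.A → x.Equivalent Smoothing.A X Y →
      Y (x.end₀ c) ≠ Y (x.end₂ c) → g (x.swapLabels c Y) = - g Y)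
    (W : D.EnhancedState) :
    ∑ Y ∈ Finset.univ.filter (fun Y => x.Equivalent Smoothing.A X Y), D.dMatrix R W ⟨x, Y⟩ * g Y =
      0 := by
  simp only [dMatrix, Finset.sum_mul]
  rw [Finset.sum_comm]
  refine Finset.sum_eq_zero fun c _ => ?_
  by_cases hc : x c = Smoothing.A
  · refine sum_equivalent_eq_zero hc _ fun Y hY h => ?_
    have hi : Incident c ⟨x, Y⟩ W := by
      by_contra hi
      simp [hi] at h
    have hne := hi.ne_of_left hx (hY.not_both hx hA hc)
    refine ⟨hne, ?_⟩
    rw [if_pos hi, if_pos (hi.swapLabels_left hx), hg c Y hc hY hne]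
    simp [crossingSign]
  · exact Finset.sum_eq_zero fun Y _ => by rw [if_neg fun h => hc h.1, zero_mul]

open Classical in
/-- Modulo `2`, the coefficients of the differential cancel in a sum over a `B`-equivalence class of
targets. -/
theorem sum_incident_source_eq_zero {x : D.State} (hx : x.Adequate) {X : x.Enhancement}
    (hB : ∀ Z : Set x.Circle, x.IsZone Smoothing.B Z → {u | u ∈ Z ∧ X u = 1}.Subsingleton)
    (W : D.EnhancedState) :
    ∑ Y ∈ Finset.univ.filter (fun Y => x.Equivalent Smoothing.B X Y),
      D.dMatrix (ZMod 2) ⟨x, Y⟩ W = 0 := by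
  simp only [dMatrix]
  rw [Finset.sum_comm]
  refine Finset.sum_eq_zero fun c _ => ?_
  by_cases hc : x c = Smoothing.B
  · refine sum_equivalent_eq_zero hc _ fun Y hY h => ?_
    have hi : Incident c W ⟨x, Y⟩ := by
      by_contra hi
      simp [hi] at h
    refine ⟨hi.ne_of_right hx (hY.not_both hx hB hc), ?_⟩
    rw [if_pos hi, if_pos (hi.swapLabels_right hx), CharTwo.add_self_eq_zero]
  · refine Finset.sum_eq_zero fun Y _ => if_neg fun h => hc ?_
    have := congrFun h.2.1 c
    rwa [Function.update_self] at this

/-! ### The homology classes of the traces -/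

theorem representsNonzeroClass_iff {R : Type} [CommRing R] {z : D.Chains R} :
    RepresentsNonzeroClass z ↔ D.d R z = 0 ∧ ∀ w, D.d R w ≠ z := by
  simp only [RepresentsNonzeroClass, ne_eq, Submodule.Quotient.mk_eq_zero]
  simp [Submodule.submoduleOf]

open Classical in
theorem d_sum_single {R : Type} [CommRing R] {x : D.State} (S : Finset x.Enhancement)
    (g : x.Enhancement → R) (W : D.EnhancedState) :
    D.d R (∑ Y ∈ S, Pi.single (⟨x, Y⟩ : D.EnhancedState) (g Y)) W =
      ∑ Y ∈ S, D.dMatrix R W ⟨x, Y⟩ * g Y := by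
  rw [map_sum, Finset.sum_apply]
  exact Finset.sum_congr rfl fun Y _ => by simp [d, Matrix.mulVec_single]

theorem intCast_dMatrix (W V : D.EnhancedState) :
    ((D.dMatrix ℤ W V : ℤ) : ZMod 2) = D.dMatrix (ZMod 2) W V := by
  simp only [dMatrix, Int.cast_sum, Int.cast_ite, Int.cast_zero, Int.cast_id]

theorem intCast_sgn (x : D.State) (X Y : x.Enhancement) : ((x.sgn X Y : ℤ) : ZMod 2) = 1 := by
  unfold sgn
  split_ifs
  · rfl
  · decide

theorem intCast_traceℤ (x : D.State) (X : x.Enhancement) (W : D.EnhancedState) :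
    ((traceℤ x X W : ℤ) : ZMod 2) = traceF₂ x X W := by
  classical
  simp only [traceℤ, traceF₂, Finset.sum_apply, Int.cast_sum]
  refine Finset.sum_congr rfl fun Y _ => ?_
  by_cases h : W = ⟨x, Y⟩
  · subst h; simp [intCast_sgn]
  · simp [Pi.single_eq_of_ne h]

theorem d_traceF₂ {x : D.State} (hx : x.Adequate) {X : x.Enhancement}
    (hA : ∀ Z : Set x.Circle, x.IsZone Smoothing.A Z → {u | u ∈ Z ∧ X u = 0}.Subsingleton) :
    D.d (ZMod 2) (traceF₂ x X) = 0 := by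
  funext W
  exact (d_sum_single _ (fun _ => 1) W).trans
    (sum_incident_target_eq_zero hx hA _ (fun _ _ _ _ _ => by decide) W)

theorem d_traceℤ {x : D.State} (hx : x.Adequate) {X : x.Enhancement}
    (hA : ∀ Z : Set x.Circle, x.IsZone Smoothing.A Z → {u | u ∈ Z ∧ X u = 0}.Subsingleton)
    (hX : ∀ Z : Set x.Circle, x.IsZone Smoothing.A Z → (∃ u ∈ Z, X u = 0) →
      x.IsBipartite Smoothing.A Z) :
    D.d ℤ (traceℤ x X) = 0 := by
  funext W
  exact (d_sum_single _ (x.sgn X) W).trans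
    (sum_incident_target_eq_zero hx hA _ (fun _ _ hc hY hne => sgn_swapLabels hx hX hY hc hne) W)

/-- The functional given by the `B`-equivalence class of `X` vanishes on boundaries and takes the
value `1` on the trace. -/
theorem d_ne_traceF₂ {x : D.State} (hx : x.HomogeneouslyAdequate) {X : x.Enhancement}
    (hB : ∀ Z : Set x.Circle, x.IsZone Smoothing.B Z → {u | u ∈ Z ∧ X u = 1}.Subsingleton)
    (w : D.Chains (ZMod 2)) : D.d (ZMod 2) w ≠ traceF₂ x X := by
  classical
  intro h
  have h0 : ∑ Y ∈ Finset.univ.filter (fun Y => x.Equivalent Smoothing.B X Y),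
      D.d (ZMod 2) w ⟨x, Y⟩ = 0 := by
    simp only [d, Matrix.mulVecLin_apply, Matrix.mulVec, dotProduct]
    rw [Finset.sum_comm]
    refine Finset.sum_eq_zero fun V _ => ?_
    rw [← Finset.sum_mul, sum_incident_source_eq_zero hx.1 hB, zero_mul]
  have hval : ∀ Y : x.Enhancement,
      traceF₂ x X ⟨x, Y⟩ = if x.Equivalent Smoothing.A X Y then 1 else 0 := by
    intro Y
    simp [traceF₂, Finset.sum_apply, Pi.single_apply]
  rw [h, Finset.sum_eq_single_of_mem X (by simpa using .refl _), hval, if_pos (.refl _)] at h0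
  · exact one_ne_zero h0
  · intro Y hY hne
    rw [hval, if_neg]
    exact fun hA => hne (hA.eq_of_equivalent hx (Finset.mem_filter.1 hY).2)

theorem d_ne_traceℤ {x : D.State} (hx : x.HomogeneouslyAdequate) {X : x.Enhancement}
    (hB : ∀ Z : Set x.Circle, x.IsZone Smoothing.B Z → {u | u ∈ Z ∧ X u = 1}.Subsingleton)
    (w : D.Chains ℤ) : D.d ℤ w ≠ traceℤ x X := by
  intro h
  refine d_ne_traceF₂ hx hB (fun V => (w V : ZMod 2)) (funext fun W => ?_)
  rw [← intCast_traceℤ, ← h]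
  simp [d, Matrix.mulVec, dotProduct, intCast_dMatrix]

end LinkDiagram

theorem mainTheorem4 (D : LinkDiagram) (x : D.State) (hx : x.HomogeneouslyAdequate)
    (X : x.Enhancement)
    (hA : ∀ Z : Set x.Circle, x.IsZone Smoothing.A Z → {u | u ∈ Z ∧ X u = 0}.Subsingleton)
    (hB : ∀ Z : Set x.Circle, x.IsZone Smoothing.B Z → {u | u ∈ Z ∧ X u = 1}.Subsingleton) :
    LinkDiagram.RepresentsNonzeroClass (LinkDiagram.traceF₂ x X) ∧
    ((∀ Z : Set x.Circle, x.IsZone Smoothing.A Z → (∃ u ∈ Z, X u = 0) →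
        x.IsBipartite Smoothing.A Z) →
      LinkDiagram.RepresentsNonzeroClass (LinkDiagram.traceℤ x X)) :=
  ⟨LinkDiagram.representsNonzeroClass_iff.2
      ⟨LinkDiagram.d_traceF₂ hx.1 hA, LinkDiagram.d_ne_traceF₂ hx hB⟩,
    fun hX => LinkDiagram.representsNonzeroClass_iff.2
      ⟨LinkDiagram.d_traceℤ hx.1 hA hX, LinkDiagram.d_ne_traceℤ hx hB⟩⟩
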